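/- \textbf{Conventions.} A \emph{locally ordered category} is a category in which every hom-set carries a preorder (in particular, possibly a partial order) such that composition is monotone in both arguments; a \emph{locally ordered functor} is a functor that is monotone on hom-sets, and an isomorphism of locally ordered categories consists of two mutually inverse locally ordered functors. $Poset$ and $Preord$ (posets, resp. preordered sets, and monotone maps) are locally ordered pointwise. A locally ordered category $C$ \emph{has finite colimits} if it has finite colimits in the order-enriched sense: for every finite locally ordered category $J$ and locally ordered functors $W:J^{op}\to Preord$ with finite values and $F:J\to C$, there is an object $L$ with isomorphisms $C(L,Z)\cong [J^{op},Preord](W,C(F-,Z))$ of preordered sets, natural in $Z$. For locally ordered categories $D,C$, $Lax(D,C)$ is the locally ordered category of locally ordered functors $D\to C$ and lax natural transformations, i.e. families $\alpha_d:Xd\to Yd$ with $Yf\circ\alpha_d\le\alpha_{d'}\circ Xf$ for all $f:d\to d'$, ordered pointwise. A locally ordered endofunctor $H$ (a locally ordered comonad $G$) on $C$ induces by composition, pointwise, an endofunctor $Lax(D,H)$ (a comonad $Lax(D,G)$) on $Lax(D,C)$. For an endofunctor $H$, $H\text{-}Coalg_{oplax}$ is the locally ordered category of $H$-coalgebras $x:X\to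 HX$ and oplax maps, i.e. maps $f:X\to Y$ with $Hf\circ x\le y\circ f$, ordered as in the underlying category; for a comonad $G$, $G\text{-}Coalg_{oplax}$ is defined in the same way, with coalgebras required to satisfy the counit and coassociativity axioms. A \emph{cofree comonad} on $H:C\to C$ is the comonad $C(H)=UR$ given by a locally ordered right adjoint $R$ of the forgetful functor $U:H\text{-}coalg\to C$, where $H\text{-}coalg$ is the category of $H$-coalgebras and strict coalgebra maps, ordered as in $C$. The counit of $U\dashv R$ and the coalgebra structures of the objects $RX$ give a natural transformation $\nu:C(H)\to H$. \textbf{Theorem.} (1) Let $H$ be a locally ordered endofunctor on a locally ordered category $C$ with finite colimits, let $C(H)$ be a cofree comonad on $H$, and let $D$ be a locally ordered category. Then there is a canonical isomorphism of locally ordered categories $$Lax(D,H)\text{-}Coalg_{oplax}\;\cong\; Lax(D,C(H))\text{-}Coalg_{oplax}.$$ It is the identity on underlying objects and maps in $Lax(D,C)$; its inverse composes structure maps with $Lax(D,\nu)$; and it sends $(X,x)$ to $(X,\bar x)$, where $\bar x_d$ is the $C(H)$-coalgebra structure on $Xd$ corresponding to $x_d$, i.e. the map $U\eta_{(Xd,x_d)}:Xd\to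 C(H)Xd$ underlying the unit of the adjunction. (2) For a signature $\Sigma$ let $\mathcal L_\Sigma$ be its Lawvere theory (objects: natural numbers; maps $n\to m$: $m$-tuples of $\Sigma$-terms in the variables $x_1,\dots,x_n$; composition: substitution), with discrete order on hom-sets. If $H$ is a locally ordered endofunctor on $Poset$ and $C(H)$ is a cofree comonad on $H$, then there is a canonical isomorphism, as described in (1), $$Lax(\mathcal L_\Sigma^{op},H)\text{-}Coalg_{oplax}\;\cong\; Lax(\mathcal L_\Sigma^{op},C(H))\text{-}Coalg_{oplax}.$$ (3) Let $P_f$ and $P_c$ be the endofunctors of $Preord$ sending a preordered set to the set of its finite, resp. countable, subsets, with $A\le B$ iff every $a\in A$ is below some $b\in B$, and acting on maps by image. The endofunctor $P_cP_f$ of $Preord$ has a cofree comonad, and for every cofree comonad $C(P_cP_f)$ on it there is a canonical isomorphism $Lax(\mathcal L_\Sigma^{op},P_cP_f)\text{-}Coalg_{oplax}\cong Lax(\mathcal L_\Sigma^{op},C(P_cP_f))\text{-}Coalg_{oplax}$, as described in (1), for every signature $\Sigma$ with countably many function symbols. Let moreover countably many predicate symbols be given, let $P$ be a logic program, i.e.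 a set of clauses $A\leftarrow A_1,\dots,A_k$ with $A,A_i$ atoms and the $A_i$ distinct, let $At:\mathcal L_\Sigma^{op}\to Preord$ send $n$ to the discretely ordered set of atoms with variables among $x_1,\dots,x_n$ and act by substitution, and let $p:At\to P_cP_fAt$ be the lax natural transformation for which $p_n(A)$ is the set of the sets of antecedents of those substitution instances, with variables among $x_1,\dots,x_n$, of clauses of $P$ that have head $A$. Then there is exactly one lax natural transformation $\bar p:At\to C(P_cP_f)At$ that is a $Lax(\mathcal L_\Sigma^{op},C(P_cP_f))$-coalgebra structure on $At$ with $\nu_{At}\circ\bar p=p$, and $\bar p_n=U\eta_{(At(n),p_n)}$ for every $n$. -/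

import Mathlib

open CategoryTheory

universe v v₁ v₂ v₃ u u₁ u₂ u₃

namespace LaxCoalgebra

/-! ### Locally ordered categories and functors -/

/-- A locally ordered category: every hom-set is ordered and composition is monotone in both
arguments. Homs are only required to be preordered; the case in which every hom-set is partially
ordered (for instance `PartOrd`) is included. -/
class LocallyOrdered (C : Type u) [Category.{v} C] where
  homPreorder (X Y : C) : Preorder (X ⟶ Y)
  comp_le_comp {X Y Z : C} {f f' : X ⟶ Y} {g g' : Y ⟶ Z} (hf : f ≤ f') (hg : g ≤ g') :
    f ≫ g ≤ f' ≫ g'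

attribute [reducible, instance] LocallyOrdered.homPreorder

/-- The opposite locally ordered category: arrows are reversed, the order on homs is kept. -/
instance instOpposite (C : Type u) [Category.{v} C] [LocallyOrdered C] : LocallyOrdered Cᵒᵖ where
  homPreorder X Y := Preorder.lift (fun f : X ⟶ Y => f.unop)
  comp_le_comp hf hg := LocallyOrdered.comp_le_comp (C := C) hg hf

/-- Homs of `PartOrd` with the pointwise order. -/
instance instPartOrd : LocallyOrdered PartOrd.{u} where
  homPreorder X Y := Preorder.lift (fun f : X ⟶ Y => (f.hom : X →o Y))
  comp_le_comp {_ _ _ _ f' g _} hf hg x := le_trans (g.hom.monotone (hf x)) (hg (f'.hom x))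

/-- Homs of `Preord` with the pointwise order. -/
instance instPreord : LocallyOrdered Preord.{u} where
  homPreorder X Y := Preorder.lift (fun f : X ⟶ Y => (f.hom : X →o Y))
  comp_le_comp {_ _ _ _ f' g _} hf hg x := le_trans (g.hom.monotone (hf x)) (hg (f'.hom x))

/-- A locally ordered functor: a functor that is monotone on homs. -/
class LocallyMonotone {C : Type u₁} [Category.{v₁} C] [LocallyOrdered C]
    {D : Type u₂} [Category.{v₂} D] [LocallyOrdered D] (F : C ⥤ D) : Prop where
  map_le_map : ∀ {X Y : C} {f g : X ⟶ Y}, f ≤ g → F.map f ≤ F.map g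

instance {C : Type u₁} [Category.{v₁} C] [LocallyOrdered C]
    {D : Type u₂} [Category.{v₂} D] [LocallyOrdered D]
    {E : Type u₃} [Category.{v₃} E] [LocallyOrdered E] (F : C ⥤ D) (G : D ⥤ E)
    [LocallyMonotone F] [LocallyMonotone G] : LocallyMonotone (F ⋙ G) where
  map_le_map h := LocallyMonotone.map_le_map (F := G) (LocallyMonotone.map_le_map (F := F) h)

/-- An isomorphism of locally ordered categories: mutually inverse (on the nose)
locally ordered functors. -/
structure LocallyOrderedIso (A : Type u₁) [Category.{v₁} A] [LocallyOrdered A]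
    (B : Type u₂) [Category.{v₂} B] [LocallyOrdered B] where
  hom : A ⥤ B
  inv : B ⥤ A
  hom_monotone : LocallyMonotone hom
  inv_monotone : LocallyMonotone inv
  hom_inv : hom ⋙ inv = 𝟭 A
  inv_hom : inv ⋙ hom = 𝟭 B

/-! ### Finite colimits of a locally ordered category

These are the finite (weighted) colimits of order-enriched category theory. -/

/-- A cocone with vertex `L` over a diagram `F : J ⥤ C` with weight `W : Jᵒᵖ ⥤ Preord`, i.e. an
order-enriched natural transformation from `W` to `C(F -, L)`. -/
structure WeightedCocone {J : Type u₁} [Category.{v₁} J]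
    {C : Type u} [Category.{v} C] [LocallyOrdered C]
    (W : Jᵒᵖ ⥤ Preord.{u₂}) (F : J ⥤ C) (L : C) where
  leg (j : J) : W.obj (Opposite.op j) → (F.obj j ⟶ L)
  leg_monotone (j : J) : Monotone (leg j)
  naturality {i j : J} (t : i ⟶ j) (w : W.obj (Opposite.op j)) :
    leg i ((W.map t.op).hom w) = F.map t ≫ leg j w

/-- `c` exhibits `L` as the `W`-weighted colimit of `F`: composition with `c` is an isomorphism of
ordered sets from `C(L, Z)` to the cocones with vertex `Z`. -/
structure WeightedCocone.IsColimit {J : Type u₁} [Category.{v₁} J]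
    {C : Type u} [Category.{v} C] [LocallyOrdered C]
    {W : Jᵒᵖ ⥤ Preord.{u₂}} {F : J ⥤ C} {L : C} (c : WeightedCocone W F L) : Prop where
  existsUnique {Z : C} (s : WeightedCocone W F Z) :
    ∃! h : L ⟶ Z, ∀ j w, c.leg j w ≫ h = s.leg j w
  le_of_leg_le {Z : C} (h k : L ⟶ Z) (hk : ∀ j w, c.leg j w ≫ h ≤ c.leg j w ≫ k) : h ≤ k

/-- A locally ordered category with finite colimits: every finite diagram has a colimit for every
finite weight. -/
class HasFiniteColimits (C : Type u) [Category.{v} C] [LocallyOrdered C] : Prop where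
  exists_isColimit (J : Type) [SmallCategory J] [LocallyOrdered J] [Finite J]
    [∀ i j : J, Finite (i ⟶ j)] (W : Jᵒᵖ ⥤ Preord.{0}) [LocallyMonotone W]
    [∀ j, Finite (W.obj j)] (F : J ⥤ C) [LocallyMonotone F] :
    ∃ (L : C) (c : WeightedCocone W F L), c.IsColimit

/-! ### The locally ordered category `Lax(D, C)` -/

section Lax

/-- Objects of `Lax(D, C)`: locally ordered functors. -/
structure Lax (D : Type u₁) [Category.{v₁} D] [LocallyOrdered D]
    (C : Type u₂) [Category.{v₂} C] [LocallyOrdered C] where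
  functor : D ⥤ C
  monotone : LocallyMonotone functor

variable {D : Type u₁} [Category.{v₁} D] [LocallyOrdered D]
variable {C : Type u₂} [Category.{v₂} C] [LocallyOrdered C]

/-- Lax natural transformations: `(K f) ∘ α_d ≤ α_d' ∘ (H f)` for every `f : d ⟶ d'`. -/
@[ext]
structure LaxNatTrans (H K : Lax D C) where
  app (d : D) : H.functor.obj d ⟶ K.functor.obj d
  lax {d d' : D} (f : d ⟶ d') : app d ≫ K.functor.map f ≤ H.functor.map f ≫ app d'

instance : Category (Lax D C) where
  Hom := LaxNatTrans
  id H := ⟨fun _ => 𝟙 _, fun f => by simp⟩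
  comp {H K M} α β := ⟨fun d => α.app d ≫ β.app d, fun {d d'} f => by
    calc (α.app d ≫ β.app d) ≫ M.functor.map f
        = α.app d ≫ (β.app d ≫ M.functor.map f) := Category.assoc _ _ _
      _ ≤ α.app d ≫ (K.functor.map f ≫ β.app d') :=
          LocallyOrdered.comp_le_comp le_rfl (β.lax f)
      _ = (α.app d ≫ K.functor.map f) ≫ β.app d' := (Category.assoc _ _ _).symm
      _ ≤ (H.functor.map f ≫ α.app d') ≫ β.app d' :=
          LocallyOrdered.comp_le_comp (α.lax f) le_rfl
      _ = H.functor.map f ≫ (α.app d' ≫ β.app d') := Category.assoc _ _ _⟩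
  id_comp α := LaxNatTrans.ext (funext fun _ => Category.id_comp _)
  comp_id α := LaxNatTrans.ext (funext fun _ => Category.comp_id _)
  assoc α β γ := LaxNatTrans.ext (funext fun _ => Category.assoc _ _ _)

@[ext]
theorem Lax.hom_ext {H K : Lax D C} {α β : H ⟶ K} (h : ∀ d, α.app d = β.app d) : α = β :=
  LaxNatTrans.ext (funext h)

/-- Lax natural transformations are ordered pointwise. -/
instance : LocallyOrdered (Lax D C) where
  homPreorder H K := Preorder.lift (fun α : H ⟶ K => α.app)
  comp_le_comp hf hg d := LocallyOrdered.comp_le_comp (hf d) (hg d)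

variable (D)

/-- The locally ordered endofunctor `Lax(D, H)` on `Lax(D, C)`: composition with `H`. -/
def laxEndofunctor (H : C ⥤ C) [LocallyMonotone H] : Lax D C ⥤ Lax D C where
  obj X := ⟨X.functor ⋙ H, haveI := X.monotone; inferInstance⟩
  map {X Y} α := ⟨fun d => H.map (α.app d), fun {d d'} f => by
    have h := LocallyMonotone.map_le_map (F := H) (α.lax f)
    rw [H.map_comp, H.map_comp] at h
    exact h⟩
  map_id X := Lax.hom_ext fun _ => H.map_id _
  map_comp α β := Lax.hom_ext fun _ => H.map_comp _ _

instance (H : C ⥤ C) [LocallyMonotone H] : LocallyMonotone (laxEndofunctor D H) where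
  map_le_map h d := LocallyMonotone.map_le_map (F := H) (h d)

/-- The locally ordered comonad `Lax(D, G)` on `Lax(D, C)` given by a locally ordered comonad `G`:
counit and comultiplication are those of `G`, pointwise. -/
def laxComonad (G : Comonad C) [LocallyMonotone G.toFunctor] : Comonad (Lax D C) where
  toFunctor := laxEndofunctor D G.toFunctor
  ε :=
    { app := fun X => ⟨fun d => G.ε.app (X.functor.obj d),
        fun f => (G.ε.naturality (X.functor.map f)).symm.le⟩
      naturality := fun _ _ α => Lax.hom_ext fun d => G.ε.naturality (α.app d) }
  δ :=
    { app := fun X => ⟨fun d => G.δ.app (X.functor.obj d),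
        fun f => (G.δ.naturality (X.functor.map f)).symm.le⟩
      naturality := fun _ _ α => Lax.hom_ext fun d => G.δ.naturality (α.app d) }
  coassoc X := Lax.hom_ext fun d => G.coassoc (X.functor.obj d)
  left_counit X := Lax.hom_ext fun d => G.left_counit (X.functor.obj d)
  right_counit X := Lax.hom_ext fun d => G.right_counit (X.functor.obj d)

/-- A natural transformation between locally ordered endofunctors of `C` acts pointwise. -/
def laxNatTrans {H K : C ⥤ C} [LocallyMonotone H] [LocallyMonotone K] (τ : H ⟶ K) :
    laxEndofunctor D H ⟶ laxEndofunctor D K where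
  app X := ⟨fun d => τ.app (X.functor.obj d), fun f => (τ.naturality (X.functor.map f)).symm.le⟩
  naturality _ _ α := Lax.hom_ext fun d => τ.naturality (α.app d)

end Lax

/-! ### Coalgebras and oplax maps -/

section Coalgebras

variable {C : Type u} [Category.{v} C] [LocallyOrdered C]

/-- The category `H-coalg` of coalgebras and strict maps, ordered as in `C`. -/
instance (H : C ⥤ C) : LocallyOrdered (Endofunctor.Coalgebra H) where
  homPreorder A B := Preorder.lift (fun f : A ⟶ B => f.f)
  comp_le_comp hf hg := LocallyOrdered.comp_le_comp (C := C) hf hg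

/-- Objects of `H-coalg_oplax`: coalgebras for the endofunctor `H`. -/
structure OplaxCoalg (H : C ⥤ C) where
  coalg : Endofunctor.Coalgebra H

/-- Oplax maps of `H`-coalgebras: `H f ∘ x ≤ y ∘ f`. -/
@[ext]
structure OplaxCoalg.Hom {H : C ⥤ C} (A B : OplaxCoalg H) where
  f : A.coalg.V ⟶ B.coalg.V
  oplax : A.coalg.str ≫ H.map f ≤ f ≫ B.coalg.str

theorem oplax_comp {H : C ⥤ C} {X Y Z : C} {x : X ⟶ H.obj X} {y : Y ⟶ H.obj Y} {z : Z ⟶ H.obj Z}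
    {f : X ⟶ Y} {g : Y ⟶ Z} (hf : x ≫ H.map f ≤ f ≫ y) (hg : y ≫ H.map g ≤ g ≫ z) :
    x ≫ H.map (f ≫ g) ≤ (f ≫ g) ≫ z := by
  calc x ≫ H.map (f ≫ g) = (x ≫ H.map f) ≫ H.map g := by simp
    _ ≤ (f ≫ y) ≫ H.map g := LocallyOrdered.comp_le_comp hf le_rfl
    _ = f ≫ (y ≫ H.map g) := Category.assoc _ _ _
    _ ≤ f ≫ (g ≫ z) := LocallyOrdered.comp_le_comp le_rfl hg
    _ = (f ≫ g) ≫ z := (Category.assoc _ _ _).symm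

instance (H : C ⥤ C) : Category (OplaxCoalg H) where
  Hom := OplaxCoalg.Hom
  id A := ⟨𝟙 _, by simp⟩
  comp f g := ⟨f.f ≫ g.f, oplax_comp f.oplax g.oplax⟩
  id_comp _ := OplaxCoalg.Hom.ext (Category.id_comp _)
  comp_id _ := OplaxCoalg.Hom.ext (Category.comp_id _)
  assoc _ _ _ := OplaxCoalg.Hom.ext (Category.assoc _ _ _)

instance (H : C ⥤ C) : LocallyOrdered (OplaxCoalg H) where
  homPreorder A B := Preorder.lift (fun f : A ⟶ B => f.f)
  comp_le_comp hf hg := LocallyOrdered.comp_le_comp (C := C) hf hg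

/-- Objects of `G-Coalg_oplax`: coalgebras for the comonad `G`. -/
structure OplaxComonadCoalg (G : Comonad C) where
  coalg : G.Coalgebra

/-- Oplax maps of coalgebras for a comonad `G`: `G f ∘ x ≤ y ∘ f`. -/
@[ext]
structure OplaxComonadCoalg.Hom {G : Comonad C} (A B : OplaxComonadCoalg G) where
  f : A.coalg.A ⟶ B.coalg.A
  oplax : A.coalg.a ≫ G.map f ≤ f ≫ B.coalg.a

instance (G : Comonad C) : Category (OplaxComonadCoalg G) where
  Hom := OplaxComonadCoalg.Hom
  id A := ⟨𝟙 _, by simp⟩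
  comp f g := ⟨f.f ≫ g.f, oplax_comp f.oplax g.oplax⟩
  id_comp _ := OplaxComonadCoalg.Hom.ext (Category.id_comp _)
  comp_id _ := OplaxComonadCoalg.Hom.ext (Category.comp_id _)
  assoc _ _ _ := OplaxComonadCoalg.Hom.ext (Category.assoc _ _ _)

instance (G : Comonad C) : LocallyOrdered (OplaxComonadCoalg G) where
  homPreorder A B := Preorder.lift (fun f : A ⟶ B => f.f)
  comp_le_comp hf hg := LocallyOrdered.comp_le_comp (C := C) hf hg

end Coalgebras

/-! ### Cofree comonads -/

section Cofree

variable {C : Type u} [Category.{v} C] [LocallyOrdered C]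

/-- A cofree comonad on the endofunctor `H`: a locally ordered right adjoint of the forgetful
functor `H-coalg ⥤ C`. The comonad itself is `CofreeComonad.comonad`. -/
structure CofreeComonad (H : C ⥤ C) where
  right : C ⥤ Endofunctor.Coalgebra H
  adj : Endofunctor.Coalgebra.forget H ⊣ right
  right_monotone : LocallyMonotone right

namespace CofreeComonad

variable {H : C ⥤ C} (E : CofreeComonad H)

/-- The comonad `C(H)`: the forgetful functor composed with its right adjoint. -/
def comonad : Comonad C := E.adj.toComonad

instance : LocallyMonotone E.comonad.toFunctor where
  map_le_map h := E.right_monotone.map_le_map h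

/-- The canonical natural transformation `C(H) ⟶ H`. -/
def proj : E.comonad.toFunctor ⟶ H where
  app X := (E.right.obj X).str ≫ H.map (E.adj.counit.app X)
  naturality X Y f := by
    have h := (E.right.map f).h
    have n : (E.right.map f).f ≫ E.adj.counit.app Y = E.adj.counit.app X ≫ f :=
      E.adj.counit.naturality f
    change (E.right.map f).f ≫ (E.right.obj Y).str ≫ H.map (E.adj.counit.app Y) =
      ((E.right.obj X).str ≫ H.map (E.adj.counit.app X)) ≫ H.map f
    calc (E.right.map f).f ≫ (E.right.obj Y).str ≫ H.map (E.adj.counit.app Y)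
        = ((E.right.map f).f ≫ (E.right.obj Y).str) ≫ H.map (E.adj.counit.app Y) :=
          (Category.assoc _ _ _).symm
      _ = ((E.right.obj X).str ≫ H.map (E.right.map f).f) ≫ H.map (E.adj.counit.app Y) :=
          congrArg (fun t => t ≫ H.map (E.adj.counit.app Y)) h.symm
      _ = (E.right.obj X).str ≫ H.map ((E.right.map f).f ≫ E.adj.counit.app Y) := by
          rw [Category.assoc]
          exact congrArg (fun t => (E.right.obj X).str ≫ t) (H.map_comp _ _).symm
      _ = (E.right.obj X).str ≫ H.map (E.adj.counit.app X ≫ f) :=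
          congrArg (fun t => (E.right.obj X).str ≫ H.map t) n
      _ = ((E.right.obj X).str ≫ H.map (E.adj.counit.app X)) ≫ H.map f := by
          rw [Category.assoc]
          exact congrArg (fun t => (E.right.obj X).str ≫ t) (H.map_comp _ _)

variable (D : Type u₁) [Category.{v₁} D] [LocallyOrdered D] [LocallyMonotone H]

/-- The canonical natural transformation `Lax(D, C(H)) ⟶ Lax(D, H)`, at `X`. -/
def laxProj (X : Lax D C) : (laxComonad D E.comonad).obj X ⟶ (laxEndofunctor D H).obj X :=
  (laxNatTrans D E.proj).app X

theorem laxProj_naturality {X Y : Lax D C} (α : X ⟶ Y) :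
    (laxComonad D E.comonad).map α ≫ E.laxProj D Y = E.laxProj D X ≫ (laxEndofunctor D H).map α :=
  (laxNatTrans D E.proj).naturality α

/-- The canonical functor `Lax(D, C(H))-Coalg_oplax ⥤ Lax(D, H)-Coalg_oplax`: it composes structure
maps with the canonical `Lax(D, C(H)) ⟶ Lax(D, H)` and is the identity on maps; so it commutes with
the forgetful functors to `Lax(D, C)`. -/
def laxComparison :
    OplaxComonadCoalg (laxComonad D E.comonad) ⥤ OplaxCoalg (laxEndofunctor D H) where
  obj A := ⟨⟨A.coalg.A, A.coalg.a ≫ E.laxProj D A.coalg.A⟩⟩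
  map {A B} φ := ⟨φ.f, by
    change (A.coalg.a ≫ E.laxProj D A.coalg.A) ≫ (laxEndofunctor D H).map φ.f ≤
      φ.f ≫ (B.coalg.a ≫ E.laxProj D B.coalg.A)
    calc (A.coalg.a ≫ E.laxProj D A.coalg.A) ≫ (laxEndofunctor D H).map φ.f
        = (A.coalg.a ≫ (laxComonad D E.comonad).map φ.f) ≫ E.laxProj D B.coalg.A := by
          rw [Category.assoc, Category.assoc, laxProj_naturality]
      _ ≤ (φ.f ≫ B.coalg.a) ≫ E.laxProj D B.coalg.A :=
          LocallyOrdered.comp_le_comp φ.oplax le_rfl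
      _ = φ.f ≫ (B.coalg.a ≫ E.laxProj D B.coalg.A) := Category.assoc _ _ _⟩
  map_id _ := rfl
  map_comp _ _ := rfl

variable {D}

/-- The `H`-coalgebra obtained by evaluating a `Lax(D, H)`-coalgebra at `d`. -/
def evalCoalg {X : Lax D C} (x : X ⟶ (laxEndofunctor D H).obj X) (d : D) :
    Endofunctor.Coalgebra H :=
  ⟨X.functor.obj d, x.app d⟩

/-- `ξ` is a `Lax(D, C(H))`-coalgebra structure on `X` whose composite with
`Lax(D, C(H)) ⟶ Lax(D, H)` is `x`. -/
structure IsLift {X : Lax D C} (x : X ⟶ (laxEndofunctor D H).obj X)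
    (ξ : X ⟶ (laxComonad D E.comonad).obj X) : Prop where
  counit : ξ ≫ (laxComonad D E.comonad).ε.app X = 𝟙 X
  coassoc : ξ ≫ (laxComonad D E.comonad).δ.app X = ξ ≫ (laxComonad D E.comonad).map ξ
  proj : ξ ≫ E.laxProj D X = x

/-- `ξ` is at every `d` the `C(H)`-coalgebra structure that corresponds to the `H`-coalgebra
structure `x_d`, i.e. the underlying map of the unit of the adjunction at `(X d, x_d)`. -/
def IsPointwiseUnit {X : Lax D C} (x : X ⟶ (laxEndofunctor D H).obj X)
    (ξ : X ⟶ (laxComonad D E.comonad).obj X) : Prop :=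
  ∀ d : D, ξ.app d = (E.adj.unit.app (evalCoalg x d)).f

variable (D)

/-- `Lax(D, H)-Coalg_oplax` and `Lax(D, C(H))-Coalg_oplax` are canonically isomorphic locally
ordered categories: the isomorphism is inverse to `laxComparison` (so it is the identity on
underlying objects and maps in `Lax(D, C)`), and it equips a coalgebra `(X, x)` with the structure
map that is pointwise the unit. -/
def HasCanonicalLaxIso : Prop :=
  ∃ Φ : LocallyOrderedIso (OplaxCoalg (laxEndofunctor D H))
      (OplaxComonadCoalg (laxComonad D E.comonad)),
    Φ.inv = E.laxComparison D ∧
    ∀ (X : Lax D C) (x : X ⟶ (laxEndofunctor D H).obj X),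
      ∃ (ξ : X ⟶ (laxComonad D E.comonad).obj X) (hξ : E.IsLift x ξ),
        E.IsPointwiseUnit x ξ ∧ Φ.hom.obj ⟨⟨X, x⟩⟩ = ⟨⟨X, ξ, hξ.counit, hξ.coassoc⟩⟩

end CofreeComonad

end Cofree

/-! ### First-order languages: Lawvere theory, atoms, logic programs -/

section Logic

variable (L : FirstOrder.Language.{u, v})

theorem subst_var {α : Type*} (t : L.Term α) : t.subst FirstOrder.Language.Term.var = t := by
  induction t with
  | var => rfl
  | func f ts ih => exact congrArg (FirstOrder.Language.Term.func f) (funext ih)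

theorem subst_subst {α β γ : Type*} (t : L.Term α) (f : α → L.Term β) (g : β → L.Term γ) :
    (t.subst f).subst g = t.subst (fun a => (f a).subst g) := by
  induction t with
  | var => rfl
  | func _ ts ih => exact congrArg (FirstOrder.Language.Term.func _) (funext ih)

/-- The Lawvere theory generated by the function symbols of `L`: objects are natural numbers, a map
`n ⟶ m` is an `m`-tuple of terms in the variables `x_1, …, x_n`, composition is substitution. -/
structure Lawvere (L : FirstOrder.Language.{u, v}) where
  arity : ℕ

instance : Category (Lawvere L) where
  Hom n m := Fin m.arity → L.Term (Fin n.arity)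
  id _ := FirstOrder.Language.Term.var
  comp f g := fun i => (g i).subst f
  id_comp f := funext fun i => subst_var L (f i)
  comp_id _ := rfl
  assoc f g h := funext fun i => (subst_subst L (h i) g f).symm

/-- The Lawvere theory is locally ordered by the discrete order on homs. -/
instance : LocallyOrdered (Lawvere L) where
  homPreorder _ _ :=
    { le := Eq, le_refl := fun _ => rfl, le_trans := fun _ _ _ => Eq.trans }
  comp_le_comp hf hg := congrArg₂ (· ≫ ·) hf hg

/-- Atomic formulae with variables in `α`: a predicate symbol applied to a tuple of terms. -/
def Atom (α : Type) : Type (max u v) := Σ k : ℕ, L.Relations k × (Fin k → L.Term α)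

variable {L}

def Atom.subst {α β : Type} (A : Atom L α) (θ : α → L.Term β) : Atom L β :=
  ⟨A.1, A.2.1, fun i => (A.2.2 i).subst θ⟩

theorem Atom.subst_var {α : Type} (A : Atom L α) : A.subst FirstOrder.Language.Term.var = A := by
  obtain ⟨k, R, t⟩ := A
  exact congrArg (fun s => (⟨k, R, s⟩ : Atom L α)) (funext fun i => LaxCoalgebra.subst_var L (t i))

theorem Atom.subst_subst {α β γ : Type} (A : Atom L α) (f : α → L.Term β) (g : β → L.Term γ) :
    (A.subst f).subst g = A.subst (fun a => (f a).subst g) := by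
  obtain ⟨k, R, t⟩ := A
  exact congrArg (fun s => (⟨k, R, s⟩ : Atom L γ))
    (funext fun i => LaxCoalgebra.subst_subst L (t i) f g)

/-- An atom in the variables `x_0, …, x_(n-1)`, as an atom in the variables `x_0, x_1, …`. -/
def Atom.weaken {n : ℕ} (A : Atom L (Fin n)) : Atom L ℕ :=
  A.subst (fun i => FirstOrder.Language.Term.var (i : ℕ))

variable (L)

/-- The set of atoms is discretely ordered. -/
instance (α : Type) : Preorder (Atom L α) where
  le := Eq
  le_refl _ := rfl
  le_trans _ _ _ := Eq.trans

/-- The functor `At : L_Σᵒᵖ ⥤ Preord`: it sends `n` to the discretely ordered set of atoms with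
variables among `x_1, …, x_n` and acts on maps by substitution. -/
def atoms : Lax (Lawvere L)ᵒᵖ Preord.{max u v} where
  functor :=
    { obj := fun n => Preord.of (Atom L (Fin n.unop.arity))
      map := fun f => Preord.ofHom
        ⟨fun A => Atom.subst A f.unop, fun _ _ h => congrArg (fun A => Atom.subst A f.unop) h⟩
      map_id := fun n => Preord.ext fun A => Atom.subst_var (L := L) A
      map_comp := fun f g => Preord.ext fun A => (Atom.subst_subst (L := L) A f.unop g.unop).symm }
  monotone := ⟨fun {X Y f g} h => by
    have : f = g := Quiver.Hom.unop_inj h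
    rw [this]⟩

/-- A definite clause `A ← A_1, …, A_n` with distinct `A_i`; variables are `x_0, x_1, …`. -/
structure Clause (L : FirstOrder.Language.{u, v}) where
  head : Atom L ℕ
  body : Finset (Atom L ℕ)

end Logic

/-! ### The functors `P_f` and `P_c` -/

section Powerset

/-- Finite subsets of `P`, with `A ≤ B` iff every element of `A` is below some element of `B`. -/
structure FiniteSubset (P : Type u) where
  carrier : Set P
  finite : carrier.Finite

instance (P : Type u) [Preorder P] : Preorder (FiniteSubset P) where
  le A B := ∀ a ∈ A.carrier, ∃ b ∈ B.carrier, a ≤ b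
  le_refl _ a ha := ⟨a, ha, le_rfl⟩
  le_trans _ _ _ h k a ha := by
    obtain ⟨b, hb, hab⟩ := h a ha
    obtain ⟨c, hc, hbc⟩ := k b hb
    exact ⟨c, hc, hab.trans hbc⟩

/-- `P_f`: finite subsets, with action on maps given by image. -/
def finitePowerset : Preord.{u} ⥤ Preord.{u} where
  obj P := Preord.of (FiniteSubset P)
  map f := Preord.ofHom
    { toFun := fun A => ⟨f.hom '' A.carrier, A.finite.image _⟩
      monotone' := by
        rintro A B h _ ⟨a, ha, rfl⟩
        obtain ⟨b, hb, hab⟩ := h a ha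
        exact ⟨_, ⟨b, hb, rfl⟩, f.hom.monotone hab⟩ }
  map_id P := Preord.ext fun A => congrArg (fun S => (⟨S.1, S.2⟩ : FiniteSubset P))
    (Subtype.ext (Set.image_id A.carrier) :
      (⟨id '' A.carrier, A.finite.image _⟩ : {S : Set P // S.Finite}) = ⟨A.carrier, A.finite⟩)
  map_comp {P Q R} f g := Preord.ext fun A => congrArg (fun S => (⟨S.1, S.2⟩ : FiniteSubset R))
    (Subtype.ext (Set.image_comp g.hom f.hom A.carrier) :
      (⟨(g.hom ∘ f.hom) '' A.carrier, A.finite.image _⟩ : {S : Set R // S.Finite}) =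
        ⟨g.hom '' (f.hom '' A.carrier), (A.finite.image _).image _⟩)

/-- Countable subsets of `P`, with `A ≤ B` iff every element of `A` is below some element of `B`. -/
structure CountableSubset (P : Type u) where
  carrier : Set P
  countable : carrier.Countable

instance (P : Type u) [Preorder P] : Preorder (CountableSubset P) where
  le A B := ∀ a ∈ A.carrier, ∃ b ∈ B.carrier, a ≤ b
  le_refl _ a ha := ⟨a, ha, le_rfl⟩
  le_trans _ _ _ h k a ha := by
    obtain ⟨b, hb, hab⟩ := h a ha
    obtain ⟨c, hc, hbc⟩ := k b hb
    exact ⟨c, hc, hab.trans hbc⟩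

/-- `P_c`: countable subsets, with action on maps given by image. -/
def countablePowerset : Preord.{u} ⥤ Preord.{u} where
  obj P := Preord.of (CountableSubset P)
  map f := Preord.ofHom
    { toFun := fun A => ⟨f.hom '' A.carrier, A.countable.image _⟩
      monotone' := by
        rintro A B h _ ⟨a, ha, rfl⟩
        obtain ⟨b, hb, hab⟩ := h a ha
        exact ⟨_, ⟨b, hb, rfl⟩, f.hom.monotone hab⟩ }
  map_id P := Preord.ext fun A => congrArg (fun S => (⟨S.1, S.2⟩ : CountableSubset P))
    (Subtype.ext (Set.image_id A.carrier) :
      (⟨id '' A.carrier, A.countable.image _⟩ : {S : Set P // S.Countable}) = ⟨A.carrier, A.countable⟩)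
  map_comp {P Q R} f g := Preord.ext fun A => congrArg (fun S => (⟨S.1, S.2⟩ : CountableSubset R))
    (Subtype.ext (Set.image_comp g.hom f.hom A.carrier) :
      (⟨(g.hom ∘ f.hom) '' A.carrier, A.countable.image _⟩ : {S : Set R // S.Countable}) =
        ⟨g.hom '' (f.hom '' A.carrier), (A.countable.image _).image _⟩)

instance : LocallyMonotone finitePowerset.{u} where
  map_le_map {P Q f g} h A := by
    rintro _ ⟨a, ha, rfl⟩
    exact ⟨_, ⟨a, ha, rfl⟩, h a⟩

instance : LocallyMonotone countablePowerset.{u} where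
  map_le_map {P Q f g} h A := by
    rintro _ ⟨a, ha, rfl⟩
    exact ⟨_, ⟨a, ha, rfl⟩, h a⟩

/-- `P_c P_f`. -/
abbrev countableFinitePowerset : Preord.{u} ⥤ Preord.{u} := finitePowerset ⋙ countablePowerset

end Powerset

/-! ### The coalgebra of a logic program -/

section Program

variable {L : FirstOrder.Language.{u, v}}

/-- The antecedents of those substitution instances of clauses of `P` whose head is `A` and whose
atoms have variables among `x_1, …, x_n`. Substitutions take values in terms with arbitrary
variables, so that variables not occurring in the clause impose no condition. -/
def antecedents (P : Set (Clause L)) {n : ℕ} (A : Atom L (Fin n)) :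
    Set (FiniteSubset (Atom L (Fin n))) :=
  {S | ∃ c ∈ P, ∃ θ : ℕ → L.Term ℕ,
    c.head.subst θ = A.weaken ∧
    (fun B => Atom.subst B θ) '' (c.body : Set (Atom L ℕ)) = Atom.weaken '' S.carrier}

theorem antecedents_subst (P : Set (Clause L)) {n m : ℕ} (A : Atom L (Fin n))
    (σ : Fin n → L.Term (Fin m)) (S : FiniteSubset (Atom L (Fin n))) (hS : S ∈ antecedents P A) :
    (⟨(fun B => Atom.subst B σ) '' S.carrier, S.finite.image _⟩ : FiniteSubset (Atom L (Fin m))) ∈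
      antecedents P (A.subst σ) := by
  obtain ⟨c, hc, θ, h1, h2⟩ := hS
  let τ : ℕ → L.Term ℕ := fun i => if h : i < n then
    (σ ⟨i, h⟩).subst (fun j => FirstOrder.Language.Term.var (j : ℕ))
    else FirstOrder.Language.Term.var i
  have key : ∀ B : Atom L (Fin n),
      B.weaken.subst τ = (B.subst σ).weaken := by
    intro B
    unfold Atom.weaken
    rw [Atom.subst_subst, Atom.subst_subst]
    congr 1
    funext i
    simp [τ, FirstOrder.Language.Term.subst]
  refine ⟨c, hc, fun i => (θ i).subst τ, ?_, ?_⟩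
  · rw [← Atom.subst_subst, h1, key]
  · have h3 := congrArg (fun T => (fun B => Atom.subst B τ) '' T) h2
    simp only [Set.image_image, Atom.subst_subst, key] at h3
    simp only [Set.image_image]
    exact h3

theorem antecedents_countable [Countable L.Symbols] (P : Set (Clause L)) {n : ℕ}
    (A : Atom L (Fin n)) : (antecedents P A).Countable := by
  have h1 : Countable (Atom L (Fin n)) := by
    have hR : Countable (Σ k, L.Relations k) :=
      (Sum.inr_injective (α := Σ k, L.Functions k)).countable (β := L.Symbols)
    have (k : ℕ) : Countable (L.Relations k) :=
      (sigma_mk_injective (β := fun k => L.Relations k) (i := k)).countable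
    unfold Atom
    infer_instance
  have h2 : Function.Injective (fun S : FiniteSubset (Atom L (Fin n)) => S.finite.toFinset) := by
    rintro ⟨S, hS⟩ ⟨T, hT⟩ h
    have : S = T := by simpa using h
    subst this
    rfl
  have := h2.countable
  exact Set.to_countable _

/-- The lax natural transformation `p : At ⟶ P_c P_f At` generated by a logic program `P` (a set of
clauses): `p_n` sends an atom to the set of sets of antecedents of substitution instances of
clauses with that atom as head. -/
def programStr [Countable L.Symbols] (P : Set (Clause L)) :
    atoms L ⟶ (laxEndofunctor (Lawvere L)ᵒᵖ countableFinitePowerset).obj (atoms L) where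
  app n := Preord.ofHom
    { toFun := fun A : Atom L (Fin n.unop.arity) =>
        (⟨antecedents P A, antecedents_countable P A⟩ :
          CountableSubset (FiniteSubset (Atom L (Fin n.unop.arity))))
      monotone' := by
        rintro A B rfl
        exact le_rfl }
  lax {n m} f A := by
    rintro _ ⟨S, hS, rfl⟩
    exact ⟨_, antecedents_subst P A f.unop S hS, le_rfl⟩

end Program

end LaxCoalgebra

/-!
The canonical isomorphism rests on one fact about a cofree comonad `C(H) = UR`: an oplax map of
`H`-coalgebras is also an oplax map of the corresponding `C(H)`-coalgebras
(`CofreeComonad.unit_oplax`). To see this, let `f : X ⟶ Y` be oplax, and form its mapping cylinder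
`L`, the universal object with arrows `i : X ⟶ L` and `j : Y ⟶ L` such that `i ≤ f ≫ j`. Oplaxness
of `f` is exactly what makes `L` a coalgebra for which `i` and `j` are *strict* maps. The arrow
`h : L ⟶ Y` with components `f` and the identity induces a strict map from `L` to the cofree
coalgebra `R Y`, whose restrictions along `i` and `j` are `η_X ≫ R f` and `η_Y`. So `i ≤ f ≫ j`
yields `η_X ≫ R f ≤ f ≫ η_Y`.

A lax transformation `x : X ⟶ H X` says that each `X f` is an oplax map from `x_d` to `x_d'`.
Hence the units at the coalgebras `(X d, x_d)` form a lax transformation again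
(`CofreeComonad.laxUnit`), and the same fact, applied at each `d`, deals with oplax maps in
`Lax(D, C)`. That the two passages are mutually inverse is checked pointwise, where it is the strict
comonadicity of `U` (`CofreeComonad.unit_proj`, `CofreeComonad.eq_unit`).

Finite colimits enter only through mapping cylinders, so the argument is run for the class
`HasWeakCylinders`. In the posets and in the preordered sets the cylinder of `f` is the disjoint
union of `X` and `Y` with `x ≤ y` when `f x ≤ y`.

A cofree comonad on `P_c P_f` is obtained from the final coalgebra of `X × P_c P_f (-)` on
*sets*, which exists since this functor is a quotient of a polynomial functor. Ordering it by the
greatest simulation makes it the cofree coalgebra on the preordered set `X` (`treeEquiv`).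
-/

namespace LaxCoalgebra

/-! ### Mapping cylinders -/

/-- Every arrow `f : X ⟶ Y` has a weak mapping cylinder: an object `L` with arrows `i : X ⟶ L` and
`j : Y ⟶ L` such that `i ≤ f ≫ j`, through which all such pairs of arrows factor. Uniqueness of the
factorization is not required. -/
class HasWeakCylinders (C : Type u) [Category.{v} C] [LocallyOrdered C] : Prop where
  exists_cylinder {X Y : C} (f : X ⟶ Y) : ∃ (L : C) (i : X ⟶ L) (j : Y ⟶ L), i ≤ f ≫ j ∧
    ∀ {Z : C} (a : X ⟶ Z) (b : Y ⟶ Z), a ≤ f ≫ b → ∃ h : L ⟶ Z, i ≫ h = a ∧ j ≫ h = b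

/-- The walking arrow is locally ordered by the discrete order on homs. -/
instance instFinTwo : LocallyOrdered (Fin 2) where
  homPreorder _ _ :=
    { le := fun _ _ => True, le_refl := fun _ => trivial, le_trans := fun _ _ _ _ _ => trivial }
  comp_le_comp _ _ := trivial

/-- The weight whose colimits are mapping cylinders: it sends the source of the walking arrow to
`{0 ≤ 1}` and its target to `{1}`. -/
def cylinderWeight : (Fin 2)ᵒᵖ ⥤ Preord.{0} where
  obj j := Preord.of (Set.Ici j.unop)
  map t := Preord.ofHom
    ⟨fun w => ⟨w.1, (leOfHom t.unop).trans w.2⟩, fun _ _ h => h⟩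

instance : LocallyMonotone cylinderWeight where
  map_le_map {_ _ f g} _ := by
    obtain rfl : f = g := Subsingleton.elim _ _
    exact le_rfl

/-- The mapping cylinder of `f` is the colimit of `f`, as a diagram on the walking arrow, weighted
by `cylinderWeight`. -/
instance (C : Type u) [Category.{v} C] [LocallyOrdered C] [HasFiniteColimits C] :
    HasWeakCylinders C where
  exists_cylinder {X Y} f := by
    let F : Fin 2 ⥤ C := ComposableArrows.mk₁ f
    have : LocallyMonotone F := ⟨fun {_ _ s t} _ => by
      obtain rfl : s = t := Subsingleton.elim _ _
      exact le_rfl⟩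
    have (j : (Fin 2)ᵒᵖ) : Finite (cylinderWeight.obj j) :=
      inferInstanceAs (Finite (Set.Ici j.unop))
    obtain ⟨L, c, hc⟩ := HasFiniteColimits.exists_isColimit (C := C) (Fin 2) cylinderWeight F
    let t : (0 : Fin 2) ⟶ 1 := homOfLE (by decide)
    have hF : F.map t = f := rfl
    refine ⟨L, c.leg 0 ⟨0, by simp⟩, c.leg 1 ⟨1, by simp⟩, ?_, fun {Z} a b hab => ?_⟩
    · have h := c.naturality t ⟨1, by simp⟩
      rw [hF] at h
      refine le_of_le_of_eq (c.leg_monotone 0 ?_) h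
      exact Fin.zero_le _
    · let s : WeightedCocone cylinderWeight F Z :=
        { leg := fun j => match j with
            | 0 => fun w => if w.1 = 0 then a else f ≫ b
            | 1 => fun _ => b
          leg_monotone := fun j => match j with
            | 0 => fun w w' h => by
                have h' : w.1 ≤ w'.1 := h
                change (if w.1 = 0 then a else f ≫ b) ≤ (if w'.1 = 0 then a else f ≫ b)
                by_cases h1 : w.1 = 0 <;> by_cases h2 : w'.1 = 0
                · rw [if_pos h1, if_pos h2]
                · rw [if_pos h1, if_neg h2]
                  exact hab
                · exact absurd (Fin.le_zero_iff.1 (h'.trans_eq h2)) h1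
                · rw [if_neg h1, if_neg h2]
            | 1 => fun _ _ _ => le_rfl
          naturality := fun {i j} r w => by
            match i, j, r, w with
            | 0, 0, r, w =>
              obtain rfl : r = 𝟙 _ := Subsingleton.elim _ _
              rw [F.map_id]
              exact (Category.id_comp _).symm
            | 1, 1, r, w =>
              obtain rfl : r = 𝟙 _ := Subsingleton.elim _ _
              rw [F.map_id]
              exact (Category.id_comp _).symm
            | 0, 1, r, w =>
              have hw : ((cylinderWeight.map r.op).hom w).1 ≠ 0 := fun h => by
                have h1 : (1 : Fin 2) ≤ w.1 := w.2
                have h2 : w.1 = 0 := h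
                rw [h2] at h1
                exact absurd h1 (by decide)
              exact if_neg hw
            | 1, 0, r, w => exact absurd (leOfHom r) (by decide) }
      obtain ⟨h, hh, -⟩ := hc.existsUnique s
      exact ⟨h, hh 0 _, hh 1 _⟩

/-! ### Coalgebras for a cofree comonad -/

namespace CofreeComonad

variable {C : Type u} [Category.{v} C] [LocallyOrdered C] {H : C ⥤ C} (E : CofreeComonad H)

/-- The arrow of `C` underlying the unit, that is, the `C(H)`-coalgebra structure on `X.V` that
corresponds to the `H`-coalgebra `X`. -/
def unitMap (X : Endofunctor.Coalgebra H) : X.V ⟶ (E.right.obj X.V).V := (E.adj.unit.app X).f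

theorem unitMap_naturality {X Y : Endofunctor.Coalgebra H} (k : X ⟶ Y) :
    k.f ≫ E.unitMap Y = E.unitMap X ≫ (E.right.map k.f).f :=
  congrArg Endofunctor.Coalgebra.Hom.f (E.adj.unit.naturality k)

/-- Oplax maps of `H`-coalgebras are oplax maps of the corresponding `C(H)`-coalgebras. The mapping
cylinder of `f` replaces the oplax map `f` by strict ones: it is a coalgebra, into which `X` embeds
strictly. -/
theorem unit_oplax [HasWeakCylinders C] [LocallyMonotone H] {X Y : Endofunctor.Coalgebra H}
    (f : X.V ⟶ Y.V) (hf : X.str ≫ H.map f ≤ f ≫ Y.str) :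
    E.unitMap X ≫ (E.right.map f).f ≤ f ≫ E.unitMap Y := by
  obtain ⟨L, i, j, hij, desc⟩ := HasWeakCylinders.exists_cylinder f
  obtain ⟨l, hil, hjl⟩ := desc (X.str ≫ H.map i) (Y.str ≫ H.map j) (by
    calc X.str ≫ H.map i ≤ X.str ≫ H.map (f ≫ j) :=
          LocallyOrdered.comp_le_comp le_rfl (LocallyMonotone.map_le_map hij)
      _ = (X.str ≫ H.map f) ≫ H.map j := by rw [H.map_comp, Category.assoc]
      _ ≤ (f ≫ Y.str) ≫ H.map j := LocallyOrdered.comp_le_comp hf le_rfl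
      _ = f ≫ Y.str ≫ H.map j := Category.assoc _ _ _)
  obtain ⟨h, hi, hj⟩ := desc f (𝟙 Y.V) (by rw [Category.comp_id])
  let A : Endofunctor.Coalgebra H := ⟨L, l⟩
  let i' : X ⟶ A := ⟨i, hil.symm⟩
  let j' : Y ⟶ A := ⟨j, hjl.symm⟩
  -- A strict map `k : Z ⟶ A` satisfies `η_Z ≫ R (k ≫ h) = k ≫ (η_A ≫ R h)`.
  have key {Z : Endofunctor.Coalgebra H} (k : Z ⟶ A) (g : Z.V ⟶ Y.V) (hg : k.f ≫ h = g) :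
      E.unitMap Z ≫ (E.right.map g).f =
        k.f ≫ E.unitMap A ≫ (E.right.map h).f := by
    rw [← hg, E.right.map_comp, Endofunctor.Coalgebra.comp_f, ← Category.assoc,
      ← E.unitMap_naturality, Category.assoc]
  have hY := key j' (𝟙 _) hj
  rw [E.right.map_id, Endofunctor.Coalgebra.id_f, Category.comp_id] at hY
  rw [key i' f hi, hY]
  refine le_of_le_of_eq (LocallyOrdered.comp_le_comp hij le_rfl) (Category.assoc _ _ _)

theorem unit_counit (X : Endofunctor.Coalgebra H) :
    E.unitMap X ≫ E.adj.counit.app X.V = 𝟙 X.V :=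
  E.adj.left_triangle_components X

theorem unit_coassoc (X : Endofunctor.Coalgebra H) :
    E.unitMap X ≫ E.unitMap (E.right.obj X.V) = E.unitMap X ≫ (E.right.map (E.unitMap X)).f :=
  E.unitMap_naturality (E.adj.unit.app X)

/-- The `H`-coalgebra induced by the `C(H)`-coalgebra of `X` is `X` again. -/
theorem unit_proj (X : Endofunctor.Coalgebra H) : E.unitMap X ≫ E.proj.app X.V = X.str := by
  have h : X.str ≫ H.map (E.unitMap X) = E.unitMap X ≫ (E.right.obj X.V).str :=
    (E.adj.unit.app X).h
  have h' : H.map (E.unitMap X) ≫ H.map (E.adj.counit.app X.V) = 𝟙 _ :=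
    (H.map_comp _ _).symm.trans ((congrArg (fun t => H.map t) (E.unit_counit X)).trans
      (H.map_id _))
  calc E.unitMap X ≫ (E.right.obj X.V).str ≫ H.map (E.adj.counit.app X.V)
      = (E.unitMap X ≫ (E.right.obj X.V).str) ≫ H.map (E.adj.counit.app X.V) :=
        (Category.assoc _ _ _).symm
    _ = (X.str ≫ H.map (E.unitMap X)) ≫ H.map (E.adj.counit.app X.V) :=
        congrArg (fun t => t ≫ H.map (E.adj.counit.app X.V)) h.symm
    _ = X.str ≫ H.map (E.unitMap X) ≫ H.map (E.adj.counit.app X.V) := Category.assoc _ _ _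
    _ = X.str := (congrArg (fun t => X.str ≫ t) h').trans (Category.comp_id _)

/-- A coalgebra for `C(H)` is determined by the `H`-coalgebra that it induces: its structure map is
the unit at that coalgebra. -/
theorem eq_unit {X : C} (a : X ⟶ E.comonad.obj X) (x : X ⟶ H.obj X)
    (counit : a ≫ E.comonad.ε.app X = 𝟙 X)
    (coassoc : a ≫ E.comonad.δ.app X = a ≫ E.comonad.map a)
    (proj : a ≫ E.proj.app X = x) : a = E.unitMap ⟨X, x⟩ := by
  let str : E.comonad.obj X ⟶ H.obj (E.comonad.obj X) := (E.right.obj X).str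
  have hδ : E.comonad.δ.app X ≫ E.proj.app (E.comonad.obj X) = str :=
    E.unit_proj (E.right.obj X)
  -- `a` is a strict coalgebra map into the cofree coalgebra.
  have ha : x ≫ H.map a = a ≫ str := by
    calc x ≫ H.map a = (a ≫ E.proj.app X) ≫ H.map a := by rw [proj]
      _ = a ≫ E.proj.app X ≫ H.map a := Category.assoc _ _ _
      _ = a ≫ E.comonad.map a ≫ E.proj.app (E.comonad.obj X) :=
          congrArg (fun t => a ≫ t) (E.proj.naturality a).symm
      _ = (a ≫ E.comonad.map a) ≫ E.proj.app (E.comonad.obj X) := (Category.assoc _ _ _).symm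
      _ = (a ≫ E.comonad.δ.app X) ≫ E.proj.app (E.comonad.obj X) := by rw [coassoc]
      _ = a ≫ E.comonad.δ.app X ≫ E.proj.app (E.comonad.obj X) := Category.assoc _ _ _
      _ = a ≫ str := by rw [hδ]
  let a' : (⟨X, x⟩ : Endofunctor.Coalgebra H) ⟶ E.right.obj X := ⟨a, ha⟩
  have h : (E.adj.homEquiv ⟨X, x⟩ X).symm a' = 𝟙 X :=
    (E.adj.homEquiv_counit (g := a')).trans counit
  have h' : a' = E.adj.unit.app ⟨X, x⟩ := by
    rw [← (E.adj.homEquiv ⟨X, x⟩ X).apply_symm_apply a', h]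
    exact (E.adj.homEquiv_id _)
  exact congrArg Endofunctor.Coalgebra.Hom.f h'

/-! ### The canonical isomorphism -/

variable {D : Type u₁} [Category.{v₁} D] [LocallyOrdered D] [LocallyMonotone H]

/-- The units at the coalgebras `(X d, x_d)` form a lax natural transformation. -/
def laxUnit [HasWeakCylinders C] {X : Lax D C} (x : X ⟶ (laxEndofunctor D H).obj X) :
    X ⟶ (laxComonad D E.comonad).obj X where
  app d := E.unitMap (evalCoalg x d)
  lax {d d'} f := E.unit_oplax (X := evalCoalg x d) (Y := evalCoalg x d') (X.functor.map f)
    (x.lax f)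

theorem isLift_laxUnit [HasWeakCylinders C] {X : Lax D C}
    (x : X ⟶ (laxEndofunctor D H).obj X) : E.IsLift x (E.laxUnit x) where
  counit := Lax.hom_ext fun d => E.unit_counit (evalCoalg x d)
  coassoc := Lax.hom_ext fun d => E.unit_coassoc (evalCoalg x d)
  proj := Lax.hom_ext fun d => E.unit_proj (evalCoalg x d)

theorem IsLift.eq_laxUnit [HasWeakCylinders C] {X : Lax D C}
    {x : X ⟶ (laxEndofunctor D H).obj X} {ξ : X ⟶ (laxComonad D E.comonad).obj X}
    (h : E.IsLift x ξ) : ξ = E.laxUnit x :=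
  Lax.hom_ext fun d => E.eq_unit (ξ.app d) (x.app d)
    (congrArg (fun α => LaxNatTrans.app α d) h.counit)
    (congrArg (fun α => LaxNatTrans.app α d) h.coassoc)
    (congrArg (fun α => LaxNatTrans.app α d) h.proj)

variable (D) in
/-- The functor `Lax(D, H)-Coalg_oplax ⥤ Lax(D, C(H))-Coalg_oplax` inverse to `laxComparison`. -/
def laxCofree [HasWeakCylinders C] :
    OplaxCoalg (laxEndofunctor D H) ⥤ OplaxComonadCoalg (laxComonad D E.comonad) where
  obj A := ⟨⟨A.coalg.V, E.laxUnit A.coalg.str, (E.isLift_laxUnit _).counit,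
    (E.isLift_laxUnit _).coassoc⟩⟩
  map {A B} φ := ⟨φ.f, fun d => E.unit_oplax (X := evalCoalg A.coalg.str d)
    (Y := evalCoalg B.coalg.str d) (φ.f.app d) (φ.oplax d)⟩
  map_id _ := rfl
  map_comp _ _ := rfl

theorem laxCofree_comparison [HasWeakCylinders C] :
    E.laxCofree D ⋙ E.laxComparison D = 𝟭 _ := by
  have hobj (A : OplaxCoalg (laxEndofunctor D H)) :
      (E.laxCofree D ⋙ E.laxComparison D).obj A = A := by
    obtain ⟨⟨X, x⟩⟩ := A
    exact congrArg (fun y => OplaxCoalg.mk ⟨X, y⟩) (E.isLift_laxUnit x).proj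
  -- The objects that are identified have the same carrier, so `eqToHom` is an identity there.
  have hf {A B : OplaxCoalg (laxEndofunctor D H)} (h : A = B) :
      (eqToHom h).f = eqToHom (congrArg (fun T => T.coalg.V) h) := by
    subst h; rfl
  refine CategoryTheory.Functor.ext hobj fun A B φ => OplaxCoalg.Hom.ext ?_
  change φ.f = (eqToHom (hobj A)).f ≫ φ.f ≫ (eqToHom (hobj B).symm).f
  rw [hf, hf]
  exact (Category.id_comp _ |>.trans (Category.comp_id _)).symm

theorem comparison_laxCofree [HasWeakCylinders C] :
    E.laxComparison D ⋙ E.laxCofree D = 𝟭 _ := by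
  have hobj (A : OplaxComonadCoalg (laxComonad D E.comonad)) :
      (E.laxComparison D ⋙ E.laxCofree D).obj A = A := by
    obtain ⟨⟨X, a, h1, h2⟩⟩ := A
    have h : a = E.laxUnit (a ≫ E.laxProj D X) := IsLift.eq_laxUnit E ⟨h1, h2, rfl⟩
    change OplaxComonadCoalg.mk ⟨X, E.laxUnit (a ≫ E.laxProj D X), _, _⟩ = _
    congr 2
    exact h.symm
  -- The objects that are identified have the same carrier, so `eqToHom` is an identity there.
  have hf {A B : OplaxComonadCoalg (laxComonad D E.comonad)} (h : A = B) :
      (eqToHom h).f = eqToHom (congrArg (fun T => T.coalg.A) h) := by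
    subst h; rfl
  refine CategoryTheory.Functor.ext hobj fun A B φ => OplaxComonadCoalg.Hom.ext ?_
  change φ.f = (eqToHom (hobj A)).f ≫ φ.f ≫ (eqToHom (hobj B).symm).f
  rw [hf, hf]
  exact (Category.id_comp _ |>.trans (Category.comp_id _)).symm

variable (D) in
theorem hasCanonicalLaxIso [HasWeakCylinders C] : E.HasCanonicalLaxIso D :=
  ⟨{ hom := E.laxCofree D
     inv := E.laxComparison D
     hom_monotone := ⟨fun h => h⟩
     inv_monotone := ⟨fun h => h⟩
     hom_inv := E.laxCofree_comparison
     inv_hom := E.comparison_laxCofree }, rfl,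
    fun _ x => ⟨E.laxUnit x, E.isLift_laxUnit x, fun _ => rfl, rfl⟩⟩

end CofreeComonad

/-! ### Mapping cylinders of posets and preordered sets -/

/-- The mapping cylinder of a monotone map `f : X → Y`: the disjoint union of `X` and `Y`, in which
`x : X` is below `y : Y` when `f x ≤ y`. -/
inductive Cylinder {X Y : Type u} [Preorder X] [Preorder Y] (f : X →o Y) : Type u
  | inl (x : X) : Cylinder f
  | inr (y : Y) : Cylinder f

namespace Cylinder

section Preorder

variable {X Y : Type u} [Preorder X] [Preorder Y] {f : X →o Y}

/-- The order relation of the mapping cylinder. -/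
protected def Le : Cylinder f → Cylinder f → Prop
  | inl x, inl x' => x ≤ x'
  | inl x, inr y => f x ≤ y
  | inr _, inl _ => False
  | inr y, inr y' => y ≤ y'

instance : Preorder (Cylinder f) where
  le := Cylinder.Le
  le_refl
    | inl x => le_refl x
    | inr y => le_refl y
  le_trans
    | inl _, inl _, inl _, h, k => le_trans (α := X) h k
    | inl _, inl _, inr _, h, k => le_trans (α := Y) (f.monotone h) k
    | inl _, inr _, inr _, h, k => le_trans (α := Y) h k
    | inr _, inr _, inr _, h, k => le_trans (α := Y) h k

variable (f) in
/-- The inclusion of the source. -/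
def source : X →o Cylinder f := ⟨inl, fun _ _ h => h⟩

variable (f) in
/-- The inclusion of the target. -/
def target : Y →o Cylinder f := ⟨inr, fun _ _ h => h⟩

/-- The map out of the mapping cylinder given by a pair of monotone maps. -/
def desc {Z : Type u} [Preorder Z] (a : X →o Z) (b : Y →o Z) (h : a ≤ b.comp f) :
    Cylinder f →o Z where
  toFun
    | inl x => a x
    | inr y => b y
  monotone'
    | inl _, inl _, k => a.monotone k
    | inl x, inr _, k => (h x).trans (b.monotone k)
    | inr _, inr _, k => b.monotone k

end Preorder

instance {X Y : Type u} [PartialOrder X] [PartialOrder Y] {f : X →o Y} :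
    PartialOrder (Cylinder f) where
  le_antisymm
    | inl _, inl _, h, k => congrArg inl (le_antisymm (α := X) h k)
    | inr _, inr _, h, k => congrArg inr (le_antisymm (α := Y) h k)

end Cylinder

instance : HasWeakCylinders PartOrd.{u} where
  exists_cylinder f := ⟨PartOrd.of (Cylinder f.hom), PartOrd.ofHom (Cylinder.source f.hom),
    PartOrd.ofHom (Cylinder.target f.hom), fun x => le_refl (f.hom x),
    fun a b h => ⟨PartOrd.ofHom (Cylinder.desc a.hom b.hom h), rfl, rfl⟩⟩

instance : HasWeakCylinders Preord.{u} where
  exists_cylinder f := ⟨Preord.of (Cylinder f.hom), Preord.ofHom (Cylinder.source f.hom),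
    Preord.ofHom (Cylinder.target f.hom), fun x => le_refl (f.hom x),
    fun a b h => ⟨Preord.ofHom (Cylinder.desc a.hom b.hom h), rfl, rfl⟩⟩

/-! ### Final coalgebras of sets -/

/-- Countable sets of finite subsets of `A`: the underlying set of `P_c P_f A`. -/
abbrev CountableFinite (A : Type u) : Type u := CountableSubset (FiniteSubset A)

namespace CountableFinite

theorem finiteSubset_ext {A : Type u} {S T : FiniteSubset A} (h : S.carrier = T.carrier) :
    S = T := by
  obtain ⟨S, _⟩ := S
  obtain ⟨T, _⟩ := T
  obtain rfl : S = T := h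
  rfl

theorem countableSubset_ext {A : Type u} {S T : CountableSubset A} (h : S.carrier = T.carrier) :
    S = T := by
  obtain ⟨S, _⟩ := S
  obtain ⟨T, _⟩ := T
  obtain rfl : S = T := h
  rfl

/-- The image of a finite subset. -/
def imageFinite {A : Type u} {B : Type v} (f : A → B) (S : FiniteSubset A) : FiniteSubset B :=
  ⟨f '' S.carrier, S.finite.image f⟩

/-- The action of `P_c P_f` on functions, also between different universes. -/
def image {A : Type u} {B : Type v} (f : A → B) (S : CountableFinite A) : CountableFinite B :=
  ⟨imageFinite f '' S.carrier, S.countable.image _⟩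

theorem imageFinite_imageFinite {A : Type u} {B : Type v} {C : Type*} (f : A → B) (g : B → C)
    (S : FiniteSubset A) : imageFinite g (imageFinite f S) = imageFinite (g ∘ f) S :=
  finiteSubset_ext (Set.image_image g f S.carrier)

theorem image_image {A : Type u} {B : Type v} {C : Type*} (f : A → B) (g : B → C)
    (S : CountableFinite A) : image g (image f S) = image (g ∘ f) S :=
  countableSubset_ext ((Set.image_image _ _ _).trans
    (Set.image_congr fun T _ => imageFinite_imageFinite f g T))

/-- Every element of `P_c P_f A` is the image of one over a set of natural numbers, because its
support is countable. -/
theorem exists_image_eq {A : Type u} (S : CountableFinite A) :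
    ∃ (N : Set ℕ) (T : CountableFinite N) (g : N → A), image g T = S := by
  let U : Set A := ⋃ B ∈ S.carrier, B.carrier
  have hU : Countable U := (S.countable.biUnion fun B _ => B.finite.countable).to_subtype
  obtain ⟨e, he⟩ := Countable.exists_injective_nat U
  -- `S` is pulled back along the inverse of the bijection of `U` with the range of `e`.
  let r := Equiv.ofInjective e he
  let restrict (B : FiniteSubset A) : FiniteSubset (Set.range e) :=
    ⟨r '' (Subtype.val ⁻¹' B.carrier),
      (B.finite.preimage Subtype.val_injective.injOn).image _⟩
  refine ⟨Set.range e, ⟨restrict '' S.carrier, S.countable.image _⟩, fun n => (r.symm n).1,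
    countableSubset_ext ?_⟩
  change _ '' (_ '' _) = _
  rw [Set.image_image]
  refine (Set.image_congr fun B hB => finiteSubset_ext ?_).trans (Set.image_id _)
  change _ '' (_ '' _) = B.carrier
  rw [Set.image_image]
  ext b
  simp only [Equiv.symm_apply_apply, Set.mem_image, Set.mem_preimage, Subtype.exists,
    exists_and_left, exists_prop, exists_eq_right_right, and_iff_left_iff_imp]
  exact fun hb => Set.mem_biUnion hB hb

end CountableFinite

/-- The functor `X × P_c P_f (-)` on types. The elements of its final coalgebra are viewed as trees
with nodes labelled in `X`, whose subtrees below a node form a countable set of finite sets. -/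
def LabelledTree (X : Type u) (A : Type u) : Type u := X × CountableFinite A

namespace LabelledTree

/-- `X × P_c P_f (-)` is a quotient of a polynomial functor, whose shapes are the pairs of a label
and an element of `P_c P_f N` for some `N ⊆ ℕ`. -/
noncomputable instance (X : Type u) : QPF (LabelledTree X) where
  map f p := (p.1, p.2.image f)
  P := ⟨X × Σ N : Set ℕ, CountableFinite N, fun s => ULift s.2.1⟩
  abs p := (p.1.1, p.1.2.2.image fun n => p.2 ⟨n⟩)
  repr p := ⟨(p.1, ⟨(CountableFinite.exists_image_eq p.2).choose,
      (CountableFinite.exists_image_eq p.2).choose_spec.choose⟩),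
    fun n => (CountableFinite.exists_image_eq p.2).choose_spec.choose_spec.choose n.down⟩
  abs_repr p := Prod.ext rfl
    (CountableFinite.exists_image_eq p.2).choose_spec.choose_spec.choose_spec
  abs_map f p := Prod.ext rfl (CountableFinite.image_image (fun n => p.2 ⟨n⟩) f p.1.2.2).symm

end LabelledTree

/-- The final coalgebra of `X × P_c P_f (-)` on types. -/
def Tree (X : Type u) : Type u := QPF.Cofix (LabelledTree X)

namespace Tree

variable {X : Type u}

/-- The label of the root. -/
noncomputable def label (z : Tree X) : X := (QPF.Cofix.dest (F := LabelledTree X) z).1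

/-- The countable set of finite sets of subtrees below the root. -/
noncomputable def children (z : Tree X) : CountableFinite (Tree X) :=
  (QPF.Cofix.dest (F := LabelledTree X) z).2

/-- The coalgebra map into the final coalgebra. -/
noncomputable def unfold {A : Type u} (g : A → X) (s : A → CountableFinite A) : A → Tree X :=
  QPF.Cofix.corec (F := LabelledTree X) fun a => (g a, s a)

theorem label_unfold {A : Type u} (g : A → X) (s : A → CountableFinite A) (a : A) :
    (unfold g s a).label = g a :=
  congrArg Prod.fst (QPF.Cofix.dest_corec (F := LabelledTree X) (fun a => (g a, s a)) a)

theorem children_unfold {A : Type u} (g : A → X) (s : A → CountableFinite A) (a : A) :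
    (unfold g s a).children = (s a).image (unfold g s) :=
  congrArg Prod.snd (QPF.Cofix.dest_corec (F := LabelledTree X) (fun a => (g a, s a)) a)

theorem unique_unfold {A : Type u} (g : A → X) (s : A → CountableFinite A) (h : A → Tree X)
    (hl : ∀ a, (h a).label = g a) (hc : ∀ a, (h a).children = (s a).image h) :
    h = unfold g s := by
  funext a
  let r : Tree X → Tree X → Prop := fun z z' => ∃ a, z = h a ∧ z' = unfold g s a
  refine QPF.Cofix.bisim_rel (F := LabelledTree X) r ?_ _ _ ⟨a, rfl, rfl⟩
  rintro _ _ ⟨a, rfl, rfl⟩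
  refine Prod.ext ?_ ?_
  · exact (hl a).trans (label_unfold g s a).symm
  · change (h a).children.image (Quot.mk r) = (unfold g s a).children.image (Quot.mk r)
    rw [hc, children_unfold, CountableFinite.image_image, CountableFinite.image_image]
    congr 1
    funext b
    exact Quot.sound ⟨b, rfl, rfl⟩

/-! ### The cofree comonad on `P_c P_f` -/

variable [Preorder X]

/-- A simulation of trees: along `r` labels increase, and the children of related trees are related
by the extension of `r` to countable sets of finite sets that defines the order of `P_c P_f`. -/
def IsSimulation (r : Tree X → Tree X → Prop) : Prop :=
  ∀ z z', r z z' → z.label ≤ z'.label ∧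
    ∀ A ∈ z.children.carrier, ∃ B ∈ z'.children.carrier, ∀ a ∈ A.carrier, ∃ b ∈ B.carrier, r a b

/-- Trees are ordered by the greatest simulation. This is the largest order for which labels and
children are monotone. -/
instance : Preorder (Tree X) where
  le z z' := ∃ r, IsSimulation r ∧ r z z'
  le_refl z := ⟨Eq, by
    rintro z _ rfl
    exact ⟨le_rfl, fun A hA => ⟨A, hA, fun a ha => ⟨a, ha, rfl⟩⟩⟩, rfl⟩
  le_trans z₁ z₂ z₃ := by
    rintro ⟨r, hr, h₁⟩ ⟨r', hr', h₂⟩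
    refine ⟨Relation.Comp r r', ?_, z₂, h₁, h₂⟩
    rintro x z ⟨y, hxy, hyz⟩
    refine ⟨(hr x y hxy).1.trans (hr' y z hyz).1, fun A hA => ?_⟩
    obtain ⟨B, hB, hAB⟩ := (hr x y hxy).2 A hA
    obtain ⟨C, hC, hBC⟩ := (hr' y z hyz).2 B hB
    refine ⟨C, hC, fun a ha => ?_⟩
    obtain ⟨b, hb, hab⟩ := hAB a ha
    obtain ⟨c, hc, hbc⟩ := hBC b hb
    exact ⟨c, hc, b, hab, hbc⟩

theorem label_monotone : Monotone (label : Tree X → X) := fun _ _ ⟨_, hr, h⟩ => (hr _ _ h).1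

theorem children_monotone : Monotone (children : Tree X → CountableFinite (Tree X)) := by
  rintro z z' ⟨r, hr, h⟩ A hA
  obtain ⟨B, hB, hAB⟩ := (hr _ _ h).2 A hA
  refine ⟨B, hB, fun a ha => ?_⟩
  obtain ⟨b, hb, hab⟩ := hAB a ha
  exact ⟨b, hb, r, hr, hab⟩

/-- Unfolding is monotone in the labelling as well as in the element that is unfolded: the pairs of
trees that the conclusion compares form a simulation. -/
theorem unfold_le_unfold {A : Type u} [Preorder A] {g g' : A → X} {s : A → CountableFinite A}
    (hg' : Monotone g') (hs : Monotone s) (h : g ≤ g') {a a' : A} (ha : a ≤ a') :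
    unfold g s a ≤ unfold g' s a' := by
  refine ⟨fun z z' => ∃ a a', a ≤ a' ∧ z = unfold g s a ∧ z' = unfold g' s a', ?_,
    a, a', ha, rfl, rfl⟩
  rintro _ _ ⟨a, a', ha, rfl, rfl⟩
  rw [label_unfold, label_unfold, children_unfold, children_unfold]
  refine ⟨(h a).trans (hg' ha), ?_⟩
  rintro _ ⟨S, hS, rfl⟩
  obtain ⟨T, hT, hST⟩ := hs ha S hS
  refine ⟨_, ⟨T, hT, rfl⟩, ?_⟩
  rintro _ ⟨b, hb, rfl⟩
  obtain ⟨b', hb', hbb'⟩ := hST b hb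
  exact ⟨_, ⟨b', hb', rfl⟩, b, b', hbb', rfl, rfl⟩

end Tree

/-- The cofree `P_c P_f`-coalgebra on a preordered set. -/
noncomputable def treeCoalgebra (X : Preord.{u}) :
    Endofunctor.Coalgebra countableFinitePowerset.{u} where
  V := Preord.of (Tree X)
  str := Preord.ofHom ⟨Tree.children, Tree.children_monotone⟩

/-- The universal property of the cofree coalgebra. -/
noncomputable def treeEquiv (A : Endofunctor.Coalgebra countableFinitePowerset.{u})
    (X : Preord.{u}) : (A.V ⟶ X) ≃ (A ⟶ treeCoalgebra X) where
  toFun g :=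
    { f := Preord.ofHom ⟨Tree.unfold g.hom A.str.hom, fun _ _ h =>
        Tree.unfold_le_unfold g.hom.monotone A.str.hom.monotone le_rfl h⟩
      h := Preord.ext fun a => (Tree.children_unfold g.hom A.str.hom a).symm }
  invFun k := k.f ≫ Preord.ofHom ⟨Tree.label, Tree.label_monotone⟩
  left_inv g := Preord.ext fun a => Tree.label_unfold g.hom A.str.hom a
  right_inv k := Endofunctor.Coalgebra.ext (Preord.ext fun a =>
    (congrFun (Tree.unique_unfold (fun a => (k.f.hom a).label) A.str.hom k.f.hom (fun _ => rfl)
      fun a => (congrArg (fun t => t.hom a) k.h).symm) a).symm)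

theorem treeEquiv_naturality (A A' : Endofunctor.Coalgebra countableFinitePowerset.{u})
    (X : Preord.{u}) (k : A ⟶ A') (g : A'.V ⟶ X) :
    treeEquiv A X (k.f ≫ g) = k ≫ treeEquiv A' X g :=
  (treeEquiv A X).eq_symm_apply.1
    (congrArg (fun t => k.f ≫ t) ((treeEquiv A' X).symm_apply_apply g).symm)

/-- The cofree comonad on `P_c P_f`, given by trees. -/
noncomputable def treeCofreeComonad : CofreeComonad countableFinitePowerset.{u} where
  right := Adjunction.rightAdjointOfEquiv (F := Endofunctor.Coalgebra.forget _)
    treeEquiv treeEquiv_naturality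
  adj := Adjunction.adjunctionOfEquivRight (F := Endofunctor.Coalgebra.forget _)
    treeEquiv treeEquiv_naturality
  right_monotone := ⟨fun {X _ f g} h (z : Tree X) => Tree.unfold_le_unfold
    (g := fun z : Tree X => f.hom z.label) (g' := fun z : Tree X => g.hom z.label)
    (fun _ _ hz => g.hom.monotone (Tree.label_monotone hz)) Tree.children_monotone
    (fun z => h z.label) (le_refl z)⟩

end LaxCoalgebra

theorem mainTheorem1 :
    -- the canonical isomorphism, for a locally ordered category with finite colimits
    (∀ (C : Type u₁) [Category.{v₁} C] [LaxCoalgebra.LocallyOrdered C]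
      [LaxCoalgebra.HasFiniteColimits C]
      (D : Type u₂) [Category.{v₂} D] [LaxCoalgebra.LocallyOrdered D]
      (H : C ⥤ C) [LaxCoalgebra.LocallyMonotone H] (E : LaxCoalgebra.CofreeComonad H),
      E.HasCanonicalLaxIso D) ∧
    -- the instance in which `C` is `Poset` and `D` is the opposite of a Lawvere theory
    (∀ (L : FirstOrder.Language.{u, v}) (H : PartOrd.{u₃} ⥤ PartOrd.{u₃})
      [LaxCoalgebra.LocallyMonotone H] (E : LaxCoalgebra.CofreeComonad H),
      E.HasCanonicalLaxIso (LaxCoalgebra.Lawvere L)ᵒᵖ) ∧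
    -- the coalgebraic semantics of logic programs
    (∀ (L : FirstOrder.Language.{u, v}) [Countable L.Symbols],
      Nonempty (LaxCoalgebra.CofreeComonad
        LaxCoalgebra.countableFinitePowerset.{max u v}) ∧
      ∀ E : LaxCoalgebra.CofreeComonad LaxCoalgebra.countableFinitePowerset.{max u v},
        E.HasCanonicalLaxIso (LaxCoalgebra.Lawvere L)ᵒᵖ ∧
        ∀ P : Set (LaxCoalgebra.Clause L), ∃ pbar,
          E.IsLift (LaxCoalgebra.programStr P) pbar ∧
          E.IsPointwiseUnit (LaxCoalgebra.programStr P) pbar ∧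
          ∀ q, E.IsLift (LaxCoalgebra.programStr P) q → q = pbar) := by
  refine ⟨fun C _ _ _ D _ _ H _ E => E.hasCanonicalLaxIso D,
    fun L H _ E => E.hasCanonicalLaxIso _, fun L _ =>
    ⟨⟨LaxCoalgebra.treeCofreeComonad⟩, fun E => ⟨E.hasCanonicalLaxIso _, fun P =>
      ⟨E.laxUnit (LaxCoalgebra.programStr P), E.isLift_laxUnit _, fun _ => rfl,
        fun _ hq => hq.eq_laxUnit⟩⟩⟩⟩
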